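/- Fix $b>0$, $\delta\ge 0$ and $x\in\mathbb R$. A spectrally negative Lévy process is a Lévy process (with càdlàg paths) without positive jumps that is not the negative of a subordinator. For a path $\xi=(\xi_t)_{t\ge0}$, the refracted-reflected path driven by $\xi$ and started from $x$ is the path $v$ built by the following recursion (with $\inf\varnothing=\infty$). Step 0: if $x\ge 0$, set $\tau:=0$, $z:=x$ and go to Step 1; if $x<0$, set $\tau:=0$ and go to Step 2. Step 1 (refraction from time $\tau$ and level $z$): let $a$ solve $$a_t=z+(\xi_t-\xi_\tau)-\delta\int_\tau^t 1_{\{a_u>b\}}\,du,\qquad t\ge\tau,$$ let $\sigma:=\inf\{t>\tau: a_t<0\}$, and set $v_t:=a_t$ for $\tau\le t<\sigma$. If $\sigma<\infty$, replace $\tau$ by $\sigma$ and go to Step 2. Step 2 (reflection at $0$ from time $\tau$ and level $0$): let $$u_t:=(\xi_t-\xi_\tau)+\Big(\sup_{\tau\le s\le t}\big(-(\xi_s-\xi_\tau)\big)\Big)\vee 0,\qquad t\ge\tau,$$ let $\sigma:=\inf\{t>\tau: u_t>b\}$, and set $v_t:=u_t$ for $\tau\le t<\sigma$. If $\sigma<\infty$,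 replace $\tau$ by $\sigma$, set $z:=b$ and go to Step 1. A refracted-reflected process associated with a process $X$ started from $x$ is a process $V$ such that, almost surely, the path of $V$ is the refracted-reflected path driven by the path of $X$ and started from $x$. A sequence of processes $(\xi^{(n)})_{n}$ is called strongly approximating for $\xi$ if, almost surely, $\lim_{n\to\infty}\sup_{0\le s\le t}|\xi_s-\xi^{(n)}_s|=0$ for every $t>0$. **Proposition.** On a probability space, let $X$ be a spectrally negative Lévy process started from $x$ that is of unbounded variation, that is, it is not the case that almost all of its paths have finite variation on compact time intervals. Let $(X^{(n)})_n$ be a sequence of spectrally negative Lévy processes started from $x$ (for instance of bounded variation) that is strongly approximating for $X$. Let $V$ and $V^{(n)}$ be the refracted-reflected processes associated with $X$ and $X^{(n)}$, respectively, started from $x$. Then $(V^{(n)})_n$ is strongly approximating for $V$: almost surely, $V^{(n)}\to V$ uniformly on compact time intervals. -/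

import Mathlib

open MeasureTheory ProbabilityTheory Filter Topology
open scoped NNReal ENNReal

namespace RefractedReflected

/-! ### Lévy processes

A real-valued process is a function `X : ℝ≥0 → Ω → ℝ`, and `fun t => X t ω` is its path at `ω`. -/

/-- Right-continuous with left limits. (At `t = 0` the left-limit condition is empty.) -/
def IsCadlag (f : ℝ≥0 → ℝ) : Prop :=
  ∀ t, ContinuousWithinAt f (Set.Ici t) t ∧ ∃ l, Tendsto f (𝓝[<] t) (𝓝 l)

/-- The path has no upward jump: its value never exceeds its left limit. -/
def NoPositiveJumps (f : ℝ≥0 → ℝ) : Prop :=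
  ∀ t, 0 < t → ∀ l, Tendsto f (𝓝[<] t) (𝓝 l) → f t ≤ l

/-- `X` is a Lévy process started at `x`: independent and stationary increments and, almost surely,
càdlàg paths with `X 0 = x`. -/
structure IsLevyProcess {Ω : Type*} [MeasurableSpace Ω] (P : Measure Ω) (x : ℝ)
    (X : ℝ≥0 → Ω → ℝ) : Prop where
  measurable : ∀ t, Measurable (X t)
  start : ∀ᵐ ω ∂P, X 0 ω = x
  indep_increments : HasIndepIncrements X P
  stationary_increments : ∀ s t : ℝ≥0,
    IdentDistrib (fun ω => X (s + t) ω - X s ω) (fun ω => X t ω - X 0 ω) P P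
  cadlag : ∀ᵐ ω ∂P, IsCadlag (fun t => X t ω)

/-- A spectrally negative Lévy process started at `x`: a Lévy process without positive jumps that is
not the negative of a subordinator, that is, whose paths are not almost surely nonincreasing. -/
structure IsSpectrallyNegativeLevy {Ω : Type*} [MeasurableSpace Ω] (P : Measure Ω) (x : ℝ)
    (X : ℝ≥0 → Ω → ℝ) : Prop extends IsLevyProcess P x X where
  noPositiveJumps : ∀ᵐ ω ∂P, NoPositiveJumps (fun t => X t ω)
  not_neg_subordinator : ¬ ∀ᵐ ω ∂P, Antitone (fun t => X t ω)

/-- Almost every path has finite variation on compact time intervals. -/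
def HasBoundedVariationPaths {Ω : Type*} [MeasurableSpace Ω] (P : Measure Ω)
    (X : ℝ≥0 → Ω → ℝ) : Prop :=
  ∀ᵐ ω ∂P, LocallyBoundedVariationOn (fun t => X t ω) Set.univ

/-- `ξn` is strongly approximating for `ξ`: almost surely,
`sup_{0 ≤ s ≤ t} |ξ_s - ξn_s| → 0` for every `t > 0`. The supremum is taken in `[0, ∞]`. -/
def StronglyApproximating {Ω : Type*} [MeasurableSpace Ω] (P : Measure Ω)
    (ξ : ℝ≥0 → Ω → ℝ) (ξn : ℕ → ℝ≥0 → Ω → ℝ) : Prop :=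
  ∀ᵐ ω ∂P, ∀ t : ℝ≥0, 0 < t →
    Tendsto (fun n => ⨆ s ∈ Set.Icc 0 t, ENNReal.ofReal |ξ s ω - ξn n s ω|) atTop (𝓝 0)

/-! ### Refracted and reflected paths

Throughout, `ξ` is a path of the underlying process, `b` is the refraction level and `δ` is the
refraction rate. -/

/-- `A`, restricted to `[τ, ∞)`, is the path refracted at level `b` that starts at time `τ` from
level `z`. It solves `dA_t = dξ_t - δ 1_{A_t > b} dt` for `t ≥ τ` with `A_τ = z`. -/
structure IsRefractedPath (δ b : ℝ) (ξ : ℝ≥0 → ℝ) (τ : ℝ≥0) (z : ℝ) (A : ℝ≥0 → ℝ) : Prop where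
  measurableSet_above : MeasurableSet {u : ℝ≥0 | τ ≤ u ∧ b < A u}
  eq : ∀ t, τ ≤ t → A t = z + (ξ t - ξ τ) -
    δ * ∫ u in (τ : ℝ)..(t : ℝ), Set.indicator {r : ℝ | b < A r.toNNReal} (fun _ => (1 : ℝ)) u

/-- The path reflected at the lower boundary `0` that starts at time `τ` from level `0`, at times
`t ≥ τ`. -/
noncomputable def reflectedPath (ξ : ℝ≥0 → ℝ) (τ t : ℝ≥0) : ℝ :=
  (ξ t - ξ τ) + max (⨆ s : Set.Icc τ t, -(ξ s - ξ τ)) 0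

/-- `inf {t > τ : f t < 0}`, with `inf ∅ = ∞`. -/
noncomputable def timeBelowZero (f : ℝ≥0 → ℝ) (τ : ℝ≥0) : ℝ≥0∞ :=
  sInf ((fun t : ℝ≥0 => (t : ℝ≥0∞)) '' {t | τ < t ∧ f t < 0})

/-- `inf {t > τ : f t > b}`, with `inf ∅ = ∞`. -/
noncomputable def timeAbove (b : ℝ) (f : ℝ≥0 → ℝ) (τ : ℝ≥0) : ℝ≥0∞ :=
  sInf ((fun t : ℝ≥0 => (t : ℝ≥0∞)) '' {t | τ < t ∧ b < f t})

/-! ### The recursive construction of the refracted-reflected path -/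

/-- A stage of the recursive construction: refracting from time `τ` and level `z` on (Step 1), or
reflecting from time `τ` and level `0` on (Step 2). -/
inductive Stage where
  | refract (τ : ℝ≥0) (z : ℝ)
  | reflect (τ : ℝ≥0)

/-- The stages that the recursive construction driven by `ξ` and started from `x` goes through.
* Step 0: if `x ≥ 0`, start refracting at time `0` from level `x`; otherwise start reflecting at
  time `0`.
* A refracting stage ends at the first time after its start at which the refracted path is below
  `0`; a reflecting stage then starts from level `0`.
* A reflecting stage ends at the first time after its start at which the reflected path is above
  `b`; a refracting stage then starts from level `b`. -/
inductive Visits (δ b : ℝ) (ξ : ℝ≥0 → ℝ) (x : ℝ) : Stage → Prop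
  | start_refract (hx : 0 ≤ x) : Visits δ b ξ x (Stage.refract 0 x)
  | start_reflect (hx : x < 0) : Visits δ b ξ x (Stage.reflect 0)
  | down {τ σ : ℝ≥0} {z : ℝ} {A : ℝ≥0 → ℝ} (h : Visits δ b ξ x (Stage.refract τ z))
      (hA : IsRefractedPath δ b ξ τ z A) (hσ : timeBelowZero A τ = σ) :
      Visits δ b ξ x (Stage.reflect σ)
  | up {τ σ : ℝ≥0} (h : Visits δ b ξ x (Stage.reflect τ))
      (hσ : timeAbove b (reflectedPath ξ τ) τ = σ) :
      Visits δ b ξ x (Stage.refract σ b)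

/-- `V` is the refracted-reflected path driven by `ξ` and started from `x`: it agrees with the
refracted path during each refracting stage and with the reflected path during each reflecting
stage of the recursive construction. -/
structure IsRefractedReflectedPath (δ b : ℝ) (ξ : ℝ≥0 → ℝ) (x : ℝ) (V : ℝ≥0 → ℝ) : Prop where
  refract : ∀ (τ : ℝ≥0) (z : ℝ), Visits δ b ξ x (Stage.refract τ z) →
    ∃ A, IsRefractedPath δ b ξ τ z A ∧
      ∀ t : ℝ≥0, τ ≤ t → (t : ℝ≥0∞) < timeBelowZero A τ → V t = A t
  reflect : ∀ τ : ℝ≥0, Visits δ b ξ x (Stage.reflect τ) →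
    ∀ t : ℝ≥0, τ ≤ t → (t : ℝ≥0∞) < timeAbove b (reflectedPath ξ τ) τ → V t = reflectedPath ξ τ t

/-- `V` is the refracted-reflected process associated with the process `X` started at `x`. -/
def IsRefractedReflectedProcess {Ω : Type*} [MeasurableSpace Ω] (P : Measure Ω) (δ b x : ℝ)
    (X V : ℝ≥0 → Ω → ℝ) : Prop :=
  ∀ᵐ ω ∂P, IsRefractedReflectedPath δ b (fun t => X t ω) x (fun t => V t ω)

end RefractedReflected

open RefractedReflected

/-! The proof is pathwise: for càdlàg drivers without positive jumps, the map sending the driver `ξ`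
to `V` is Lipschitz with constant 2 for the uniform distance on each `[0, T]`. Strong approximation
then passes from the drivers to the refracted-reflected paths on an almost sure event.

The recursion is first replaced by one equation, `dV = dξ - δ 1_{V > b} dt + dR` with `V ≥ 0`, where
`R` is nondecreasing and grows only while `V = 0` (`SolvesOn`). Let two solutions start from the
same point, with drivers within `ε` of each other, and put `G = (V - ξ) - (V' - ξ')`. Wherever `G >
ε`, one has `V > V' ≥ 0`. There `R` is flat, and `V` is above `b` whenever `V'` is, so both the
drift and `-R'` push `G` down. Hence `G` never exceeds `ε`, and `V - V' ≤ 2ε`; exchanging the roles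
gives the bound on `|V - V'|` (`SolvesOn.sub_le_of_abs_le`, through `le_of_no_upcrossing`).

It remains to see that the recursion yields a solution on every `[0, T]`. Each stage solves the
equation up to and including its final time, and solutions can be concatenated. The stages cannot
accumulate: a completed reflecting stage carries `ξ` up by exactly `b` from an earlier running
minimum, because the reflected path creeps over `b`, and a càdlàg path has only finitely many such
oscillations in bounded time. -/

namespace RefractedReflected

/-! ### One-dimensional path arguments -/

/-- A function that cannot increase while it stays above `c`, and cannot jump up to a value
above `c`, stays at most `c`. -/
theorem le_of_no_upcrossing {G : ℝ≥0 → ℝ} {c : ℝ} {τ T : ℝ≥0} (h0 : G τ ≤ c)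
    (h1 : ∀ s t, τ ≤ s → s ≤ t → t ≤ T → (∀ r, s < r → r ≤ t → c < G r) → G t ≤ G s)
    (h2 : ∀ s, τ < s → s ≤ T → c < G s → ∀ e > 0, ∃ r < s, ∀ q, r ≤ q → τ ≤ q → q < s →
      G s ≤ G q + e) {t : ℝ≥0} (ht : τ ≤ t) (htT : t ≤ T) : G t ≤ c := by
  by_contra! hc
  -- Consider the last time before `t` at which `G` is at most `c`. No continuity is available, so
  -- this supremum may fail to belong to the set. If it does belong, `h1` applies after it;
  -- otherwise `h2` forbids a jump over `c` at it.
  set S : Set ℝ≥0 := {r | τ ≤ r ∧ r ≤ t ∧ G r ≤ c} with hS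
  have hτS : τ ∈ S := ⟨le_rfl, ht, h0⟩
  have hbdd : BddAbove S := ⟨t, fun r hr => hr.2.1⟩
  have hle : sSup S ≤ t := csSup_le ⟨τ, hτS⟩ fun r hr => hr.2.1
  have hτ : τ ≤ sSup S := le_csSup hbdd hτS
  have habove : ∀ r, sSup S < r → r ≤ t → c < G r := by
    intro r hr hrt
    by_contra! h
    exact absurd (le_csSup hbdd (⟨hτ.trans hr.le, hrt, h⟩ : r ∈ S)) (not_le.2 hr)
  rcases le_or_gt (G (sSup S)) c with h | h
  · linarith [h1 _ t hτ hle htT habove]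
  · have hlt : τ < sSup S := by
      refine lt_of_le_of_ne hτ fun he => ?_
      rw [← he] at h
      linarith
    obtain ⟨r, hr, hq⟩ := h2 _ hlt (hle.trans htT) h ((G (sSup S) - c) / 2) (by linarith)
    obtain ⟨q, hqS, hrq⟩ := exists_lt_of_lt_csSup ⟨τ, hτS⟩ hr
    have hqs : q < sSup S := by
      refine lt_of_le_of_ne (le_csSup hbdd hqS) fun he => ?_
      rw [← he] at h
      linarith [hqS.2.2]
    linarith [hq q hrq.le hqS.1 hqs, hqS.2.2]

/-- For `s > 0`, points shortly before `s` are within `e` of it at rate `δ`. -/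
theorem exists_lt_forall_mul_sub_le {δ e : ℝ} (hδ : 0 ≤ δ) (he : 0 < e) {s : ℝ≥0} (hs : 0 < s) :
    ∃ r < s, ∀ q : ℝ≥0, r ≤ q → q < s → δ * ((s : ℝ) - q) ≤ e := by
  -- Dividing by `δ + 1` rather than `δ` covers `δ = 0`.
  have hpos : 0 < e / (δ + 1) := by positivity
  have hs' : (0 : ℝ) < s := hs
  refine ⟨((s : ℝ) - e / (δ + 1)).toNNReal, ?_, fun q hq hqs => ?_⟩
  · rw [← NNReal.coe_lt_coe, Real.coe_toNNReal', max_lt_iff]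
    exact ⟨by linarith, hs'⟩
  · have hq' : (s : ℝ) - e / (δ + 1) ≤ q := Real.toNNReal_le_iff_le_coe.1 hq
    have hqs' : (q : ℝ) < s := hqs
    have : δ * ((s : ℝ) - q) ≤ (δ + 1) * (e / (δ + 1)) := by
      apply mul_le_mul <;> linarith
    rwa [mul_div_cancel₀ _ (by positivity)] at this

/-- Right-continuity controls values after `t`, and the left limit is at least `ξ t`. This is the
form in which the absence of positive jumps is used: running minima are attained, and levels are not
jumped over upwards. -/
theorem IsCadlag.lowerSemicontinuous {ξ : ℝ≥0 → ℝ} (hξ : IsCadlag ξ) (hj : NoPositiveJumps ξ) :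
    LowerSemicontinuous ξ := by
  intro t y hy
  have hr : ∀ᶠ s in 𝓝[≥] t, y < ξ s := (hξ t).1.eventually (lt_mem_nhds hy)
  obtain ⟨l, hl⟩ := (hξ t).2
  have hleft : ∀ᶠ s in 𝓝[<] t, y < ξ s := by
    rcases eq_or_lt_of_le (zero_le (a := t)) with h | h
    · subst h
      have : Set.Iio (0 : ℝ≥0) = ∅ := by ext; simp
      rw [this, nhdsWithin_empty]
      exact eventually_bot
    · exact hl.eventually (lt_mem_nhds (hy.trans_le (hj t h l hl)))
  rw [← nhdsLT_sup_nhdsGE t]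
  exact eventually_sup.2 ⟨hleft, hr⟩

/-- The reflected path is the driving path minus its running minimum, which is attained. -/
theorem exists_reflectedPath_eq {ξ : ℝ≥0 → ℝ} (hξ : LowerSemicontinuous ξ) {τ t : ℝ≥0}
    (h : τ ≤ t) : ∃ r, τ ≤ r ∧ r ≤ t ∧ (∀ s, τ ≤ s → s ≤ t → ξ r ≤ ξ s) ∧
      reflectedPath ξ τ t = ξ t - ξ r := by
  obtain ⟨r, hr, hmin⟩ := (hξ.lowerSemicontinuousOn (Set.Icc τ t)).exists_isMinOn
    (Set.nonempty_Icc.2 h) isCompact_Icc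
  have hmin' : ∀ s, τ ≤ s → s ≤ t → ξ r ≤ ξ s := fun s h1 h2 => hmin ⟨h1, h2⟩
  refine ⟨r, hr.1, hr.2, hmin', ?_⟩
  have hsup : (⨆ s : Set.Icc τ t, -(ξ s - ξ τ)) = -(ξ r - ξ τ) := by
    have : Nonempty (Set.Icc τ t) := ⟨⟨r, hr⟩⟩
    apply le_antisymm
    · exact ciSup_le fun s => by linarith [hmin' s s.2.1 s.2.2]
    · exact le_ciSup (f := fun s : Set.Icc τ t => -(ξ s - ξ τ))
        ⟨-(ξ r - ξ τ), by rintro _ ⟨s, rfl⟩; simp only; linarith [hmin' s s.2.1 s.2.2]⟩ ⟨r, hr⟩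
  rw [reflectedPath, hsup, max_eq_left (by linarith [hmin' τ le_rfl h])]
  ring

theorem sub_le_reflectedPath {ξ : ℝ≥0 → ℝ} (hξ : LowerSemicontinuous ξ) {τ s t : ℝ≥0}
    (hs : τ ≤ s) (hst : s ≤ t) : ξ t - ξ s ≤ reflectedPath ξ τ t := by
  obtain ⟨r, -, -, hmin, h⟩ := exists_reflectedPath_eq hξ (hs.trans hst)
  linarith [hmin s hs hst]

theorem reflectedPath_nonneg {ξ : ℝ≥0 → ℝ} (hξ : LowerSemicontinuous ξ) {τ t : ℝ≥0}
    (h : τ ≤ t) : 0 ≤ reflectedPath ξ τ t := by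
  simpa using sub_le_reflectedPath hξ h le_rfl

theorem reflectedPath_self {ξ : ℝ≥0 → ℝ} (hξ : LowerSemicontinuous ξ) (τ : ℝ≥0) :
    reflectedPath ξ τ τ = 0 := by
  obtain ⟨r, h1, h2, -, h⟩ := exists_reflectedPath_eq hξ (le_refl τ)
  rw [h, le_antisymm h2 h1, sub_self]

/-! ### Occupation time above a level -/

/-- The time that `V` spends above `b` between `s` and `t`. -/
noncomputable def occ (b : ℝ) (V : ℝ≥0 → ℝ) (s t : ℝ≥0) : ℝ :=
  ∫ u in (s : ℝ)..(t : ℝ), Set.indicator {r : ℝ | b < V r.toNNReal} (fun _ => (1 : ℝ)) u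

/-- The set of times in `[s, t]` at which `V` is above `b` is measurable. -/
def MeasurableAbove (b : ℝ) (V : ℝ≥0 → ℝ) (s t : ℝ≥0) : Prop :=
  MeasurableSet {u : ℝ≥0 | s ≤ u ∧ u ≤ t ∧ b < V u}

theorem MeasurableAbove.mono {b : ℝ} {V : ℝ≥0 → ℝ} {s t s' t' : ℝ≥0}
    (h : MeasurableAbove b V s t) (hs : s ≤ s') (ht : t' ≤ t) : MeasurableAbove b V s' t' := by
  have : {u : ℝ≥0 | s' ≤ u ∧ u ≤ t' ∧ b < V u} =
      {u : ℝ≥0 | s ≤ u ∧ u ≤ t ∧ b < V u} ∩ Set.Icc s' t' := by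
    ext u
    simp only [Set.mem_ofPred_eq, Set.mem_inter_iff, Set.mem_Icc]
    constructor
    · rintro ⟨h1, h2, h3⟩
      exact ⟨⟨hs.trans h1, h2.trans ht, h3⟩, h1, h2⟩
    · rintro ⟨⟨-, -, h3⟩, h1, h2⟩
      exact ⟨h1, h2, h3⟩
  rw [MeasurableAbove, this]
  exact h.inter measurableSet_Icc

theorem MeasurableAbove.intervalIntegrable {b : ℝ} {V : ℝ≥0 → ℝ} {s t : ℝ≥0}
    (h : MeasurableAbove b V s t) (hst : s ≤ t) :
    IntervalIntegrable (Set.indicator {r : ℝ | b < V r.toNNReal} (fun _ => (1 : ℝ))) volume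
      (s : ℝ) (t : ℝ) := by
  rw [intervalIntegrable_iff_integrableOn_Icc_of_le (by exact_mod_cast hst)]
  have hm : MeasurableSet (Real.toNNReal ⁻¹' {u : ℝ≥0 | s ≤ u ∧ u ≤ t ∧ b < V u}) :=
    measurable_real_toNNReal h
  have hint : IntegrableOn (Set.indicator (Real.toNNReal ⁻¹' {u : ℝ≥0 | s ≤ u ∧ u ≤ t ∧ b < V u})
      (fun _ => (1 : ℝ))) (Set.Icc (s : ℝ) (t : ℝ)) volume :=
    (integrableOn_const (by simp)).indicator hm
  refine hint.congr_fun (fun r hr => ?_) measurableSet_Icc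
  have h1 : s ≤ r.toNNReal := NNReal.le_toNNReal_of_coe_le hr.1
  have h2 : r.toNNReal ≤ t := Real.toNNReal_le_iff_le_coe.2 hr.2
  simp [Set.indicator, h1, h2]

theorem occ_nonneg {b : ℝ} {V : ℝ≥0 → ℝ} {s t : ℝ≥0} (hst : s ≤ t) : 0 ≤ occ b V s t :=
  intervalIntegral.integral_nonneg_of_forall (by exact_mod_cast hst) fun u =>
    Set.indicator_nonneg (fun _ _ => zero_le_one (α := ℝ)) u

theorem occ_le {b : ℝ} {V : ℝ≥0 → ℝ} {s t : ℝ≥0} (h : MeasurableAbove b V s t) (hst : s ≤ t) :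
    occ b V s t ≤ t - s := by
  have := intervalIntegral.integral_mono_on (g := fun _ => (1 : ℝ)) (by exact_mod_cast hst)
    (h.intervalIntegrable hst) (by simp) fun u _ =>
      Set.indicator_le_self' (fun _ _ => zero_le_one (α := ℝ)) u
  simpa [occ] using this

theorem occ_add {b : ℝ} {V : ℝ≥0 → ℝ} {s q t : ℝ≥0} (h : MeasurableAbove b V s t)
    (hsq : s ≤ q) (hqt : q ≤ t) : occ b V s q + occ b V q t = occ b V s t :=
  intervalIntegral.integral_add_adjacent_intervals ((h.mono le_rfl hqt).intervalIntegrable hsq)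
    ((h.mono hsq le_rfl).intervalIntegrable hqt)

/-- Endpoints are excluded because `V` may differ from the refracted path at the final time of a
stage. -/
theorem occ_mono {b : ℝ} {V W : ℝ≥0 → ℝ} {s t : ℝ≥0} (hV : MeasurableAbove b V s t)
    (hW : MeasurableAbove b W s t) (hst : s ≤ t) (h : ∀ r, s < r → r < t → V r ≤ W r) :
    occ b V s t ≤ occ b W s t := by
  refine intervalIntegral.integral_mono_on_of_le_Ioo (by exact_mod_cast hst)
    (hV.intervalIntegrable hst) (hW.intervalIntegrable hst) fun r hr => ?_
  have h1 : s < r.toNNReal := Real.lt_toNNReal_iff_coe_lt.2 hr.1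
  have h2 : r.toNNReal < t := (Real.toNNReal_lt_iff_lt_coe (s.2.trans hr.1.le)).2 hr.2
  have h3 := h _ h1 h2
  by_cases hb : b < V r.toNNReal
  · simp [Set.indicator, hb, hb.trans_le h3]
  · simp only [Set.indicator, Set.mem_ofPred_eq, hb, if_false]
    split_ifs <;> simp

theorem occ_eq_zero {b : ℝ} {V : ℝ≥0 → ℝ} {s t : ℝ≥0} (hst : s ≤ t)
    (h : ∀ r, s ≤ r → r ≤ t → V r ≤ b) : occ b V s t = 0 := by
  refine (intervalIntegral.integral_congr (g := fun _ => (0 : ℝ)) fun r hr => ?_).trans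
    intervalIntegral.integral_zero
  rw [Set.uIcc_of_le (by exact_mod_cast hst)] at hr
  have := h _ (NNReal.le_toNNReal_of_coe_le hr.1) (Real.toNNReal_le_iff_le_coe.2 hr.2)
  simp [Set.indicator, not_lt.2 this]

/-! ### Refracted paths -/

namespace IsRefractedPath

variable {δ b : ℝ} {ξ : ℝ≥0 → ℝ} {τ : ℝ≥0} {z : ℝ} {A : ℝ≥0 → ℝ}

theorem measurableAbove (hA : IsRefractedPath δ b ξ τ z A) (t : ℝ≥0) :
    MeasurableAbove b A τ t := by
  have : {u : ℝ≥0 | τ ≤ u ∧ u ≤ t ∧ b < A u} = {u : ℝ≥0 | τ ≤ u ∧ b < A u} ∩ Set.Iic t := by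
    ext u
    simp only [Set.mem_ofPred_eq, Set.mem_inter_iff, Set.mem_Iic]
    tauto
  rw [MeasurableAbove, this]
  exact hA.measurableSet_above.inter measurableSet_Iic

theorem apply_start (hA : IsRefractedPath δ b ξ τ z A) : A τ = z := by
  simpa using hA.eq τ le_rfl

theorem sub_eq (hA : IsRefractedPath δ b ξ τ z A) {s t : ℝ≥0} (hs : τ ≤ s) (hst : s ≤ t) :
    A t - ξ t = A s - ξ s - δ * occ b A s t := by
  have h1 : A t = z + (ξ t - ξ τ) - δ * occ b A τ t := hA.eq t (hs.trans hst)
  have h2 : A s = z + (ξ s - ξ τ) - δ * occ b A τ s := hA.eq s hs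
  have h3 := occ_add (hA.measurableAbove t) hs hst
  rw [h1, h2, ← h3]
  ring

/-- The drift `-δ 1_{· > b}` is discontinuous but nonincreasing in the state: while `A > A'`, the
difference `A - A'` cannot grow. This one-sided monotonicity gives uniqueness. -/
theorem le_of_isRefractedPath (hδ : 0 ≤ δ) {A' : ℝ≥0 → ℝ} (hA : IsRefractedPath δ b ξ τ z A)
    (hA' : IsRefractedPath δ b ξ τ z A') {t : ℝ≥0} (ht : τ ≤ t) : A t ≤ A' t := by
  have hmain := le_of_no_upcrossing (G := fun t => A t - A' t) (c := 0) (τ := τ) (T := t)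
    (by simp [hA.apply_start, hA'.apply_start]) ?_ ?_ ht le_rfl
  · simpa using hmain
  · intro s t hs hst _ h
    have hm := mul_le_mul_of_nonneg_left (occ_mono ((hA'.measurableAbove t).mono hs le_rfl)
      ((hA.measurableAbove t).mono hs le_rfl) hst
      fun r h1 h2 => (sub_pos.1 (h r h1 h2.le)).le) hδ
    linarith [hA.sub_eq hs hst, hA'.sub_eq hs hst]
  · intro s hs _ _ e he
    obtain ⟨r, hr, hq⟩ := exists_lt_forall_mul_sub_le hδ he (zero_le.trans_lt hs)
    refine ⟨r, hr, fun q hrq hτq hqs => ?_⟩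
    have h1 := mul_nonneg hδ (occ_nonneg (b := b) (V := A) hqs.le)
    have h2 := mul_le_mul_of_nonneg_left
      (occ_le ((hA'.measurableAbove s).mono hτq le_rfl) hqs.le) hδ
    have h3 := hq q hrq hqs
    linarith [hA.sub_eq hτq hqs.le, hA'.sub_eq hτq hqs.le]

theorem unique (hδ : 0 ≤ δ) {A' : ℝ≥0 → ℝ} (hA : IsRefractedPath δ b ξ τ z A)
    (hA' : IsRefractedPath δ b ξ τ z A') {t : ℝ≥0} (ht : τ ≤ t) : A t = A' t :=
  le_antisymm (hA.le_of_isRefractedPath hδ hA' ht) (hA'.le_of_isRefractedPath hδ hA ht)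

theorem exists_forall_lt (hδ : 0 ≤ δ) (hξ : IsCadlag ξ) (hA : IsRefractedPath δ b ξ τ z A)
    {σ : ℝ≥0} (hσ : τ ≤ σ) (hpos : 0 < A σ) : ∃ t > σ, ∀ s, σ ≤ s → s < t → 0 < A s := by
  have hlim : Tendsto (fun s : ℝ≥0 => A σ - ξ σ + ξ s - δ * ((s : ℝ) - σ)) (𝓝[≥] σ)
      (𝓝 (A σ - ξ σ + ξ σ - δ * ((σ : ℝ) - σ))) := by
    have h1 : Tendsto ξ (𝓝[≥] σ) (𝓝 (ξ σ)) := (hξ σ).1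
    have h2 : Tendsto (fun s : ℝ≥0 => (s : ℝ)) (𝓝[≥] σ) (𝓝 (σ : ℝ)) :=
      (NNReal.continuous_coe.tendsto σ).mono_left nhdsWithin_le_nhds
    exact (h1.const_add _).sub ((h2.sub_const _).const_mul δ)
  have hev := hlim.eventually (lt_mem_nhds (a := 0) (by simpa using hpos))
  obtain ⟨t, ht, hsub⟩ := mem_nhdsGE_iff_exists_Ico_subset.1 hev
  refine ⟨t, ht, fun s h1 h2 => ?_⟩
  have h3 : 0 < A σ - ξ σ + ξ s - δ * ((s : ℝ) - σ) := hsub ⟨h1, h2⟩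
  have h4 := mul_le_mul_of_nonneg_left
    (occ_le ((hA.measurableAbove s).mono hσ le_rfl) h1) hδ
  linarith [hA.sub_eq hσ h1]

end IsRefractedPath

/-! ### First passage times -/

section hitting

variable {f : ℝ≥0 → ℝ} {b : ℝ} {τ σ t : ℝ≥0}

theorem le_timeBelowZero : (τ : ℝ≥0∞) ≤ timeBelowZero f τ :=
  le_sInf (by rintro _ ⟨t, ht, rfl⟩; exact ENNReal.coe_le_coe.2 ht.1.le)

theorem nonneg_of_lt_timeBelowZero (hτ : τ < t) (ht : (t : ℝ≥0∞) < timeBelowZero f τ) :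
    0 ≤ f t := by
  by_contra! h
  exact not_le.2 ht (sInf_le ⟨t, ⟨hτ, h⟩, rfl⟩)

theorem lt_timeBelowZero_of_forall (h : σ < t) (hf : ∀ s, τ < s → s < t → 0 ≤ f s) :
    (σ : ℝ≥0∞) < timeBelowZero f τ := by
  refine lt_of_lt_of_le (b := (t : ℝ≥0∞)) (by exact_mod_cast h) (le_sInf ?_)
  rintro _ ⟨s, hs, rfl⟩
  by_contra! hst
  exact absurd (hf s hs.1 (by exact_mod_cast hst)) (not_le.2 hs.2)

theorem le_of_lt_timeAbove (hτ : τ < t) (ht : (t : ℝ≥0∞) < timeAbove b f τ) : f t ≤ b := by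
  by_contra! h
  exact not_le.2 ht (sInf_le ⟨t, ⟨hτ, h⟩, rfl⟩)

theorem lt_timeAbove_of_forall (h : σ < t) (hf : ∀ s, τ < s → s < t → f s ≤ b) :
    (σ : ℝ≥0∞) < timeAbove b f τ := by
  refine lt_of_lt_of_le (b := (t : ℝ≥0∞)) (by exact_mod_cast h) (le_sInf ?_)
  rintro _ ⟨s, hs, rfl⟩
  by_contra! hst
  exact absurd (hf s hs.1 (by exact_mod_cast hst)) (not_le.2 hs.2)

theorem timeBelowZero_congr {g : ℝ≥0 → ℝ} (h : ∀ t, τ ≤ t → f t = g t) :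
    timeBelowZero f τ = timeBelowZero g τ := by
  have : {t | τ < t ∧ f t < 0} = {t | τ < t ∧ g t < 0} := by
    ext t
    exact and_congr_right fun ht => by rw [h t (le_of_lt ht)]
  rw [timeBelowZero, this, timeBelowZero]

end hitting

/-- A refracted path is nonpositive when it first passes below `0`. -/
theorem IsRefractedPath.apply_timeBelowZero_nonpos {δ b : ℝ} (hδ : 0 ≤ δ) {ξ : ℝ≥0 → ℝ}
    (hξ : IsCadlag ξ) {τ σ : ℝ≥0} {z : ℝ} {A : ℝ≥0 → ℝ} (hA : IsRefractedPath δ b ξ τ z A)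
    (hσ : timeBelowZero A τ = σ) : A σ ≤ 0 := by
  have hτσ : τ ≤ σ := by
    have := le_timeBelowZero (f := A) (τ := τ)
    rw [hσ] at this
    exact_mod_cast this
  by_contra! hpos
  obtain ⟨t, ht, hpos'⟩ := hA.exists_forall_lt hδ hξ hτσ hpos
  have : (σ : ℝ≥0∞) < timeBelowZero A τ := by
    refine lt_timeBelowZero_of_forall ht fun s h1 h2 => ?_
    rcases le_or_gt σ s with h | h
    · exact (hpos' s h h2).le
    · exact nonneg_of_lt_timeBelowZero h1 (by rw [hσ]; exact_mod_cast h)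
  exact absurd this (by rw [hσ]; exact lt_irrefl _)

theorem IsRefractedPath.lt_timeBelowZero {δ b : ℝ} (hδ : 0 ≤ δ) {ξ : ℝ≥0 → ℝ}
    (hξ : IsCadlag ξ) {τ : ℝ≥0} {z : ℝ} {A : ℝ≥0 → ℝ} (hA : IsRefractedPath δ b ξ τ z A)
    (hz : 0 < z) : (τ : ℝ≥0∞) < timeBelowZero A τ := by
  obtain ⟨t, ht, hpos⟩ := hA.exists_forall_lt hδ hξ le_rfl (by rwa [hA.apply_start])
  exact lt_timeBelowZero_of_forall ht fun s h1 h2 => (hpos s h1.le h2).le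

/-- While a reflected path is below `b` it stays below `b` for a positive time. -/
theorem exists_forall_reflectedPath_lt {ξ : ℝ≥0 → ℝ} (hξ : IsCadlag ξ)
    (hl : LowerSemicontinuous ξ) {b : ℝ} {τ σ : ℝ≥0} (hσ : τ ≤ σ)
    (hb : reflectedPath ξ τ σ < b) (hb0 : 0 < b) :
    ∃ t > σ, ∀ s, σ ≤ s → s < t → reflectedPath ξ τ s < b := by
  have hcts : Tendsto ξ (𝓝[≥] σ) (𝓝 (ξ σ)) := (hξ σ).1
  -- The first bound serves when the running minimum is attained before `σ`, the second when it is
  -- attained after `σ`, where `ξ` oscillates by less than `2 * e`.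
  obtain ⟨e, he, heb, he0⟩ : ∃ e > 0, reflectedPath ξ τ σ + e < b ∧ 2 * e < b := by
    refine ⟨min ((b - reflectedPath ξ τ σ) / 2) (b / 3), lt_min (by linarith) (by linarith), ?_, ?_⟩
    · linarith [min_le_left ((b - reflectedPath ξ τ σ) / 2) (b / 3)]
    · linarith [min_le_right ((b - reflectedPath ξ τ σ) / 2) (b / 3)]
  have hev := hcts.eventually (Metric.ball_mem_nhds (ξ σ) he)
  obtain ⟨t, ht, hsub⟩ := mem_nhdsGE_iff_exists_Ico_subset.1 hev
  have hclose : ∀ s, σ ≤ s → s < t → |ξ s - ξ σ| < e := fun s h1 h2 => hsub ⟨h1, h2⟩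
  refine ⟨t, ht, fun s h1 h2 => ?_⟩
  obtain ⟨r, hr1, hr2, -, hr⟩ := exists_reflectedPath_eq hl (hσ.trans h1)
  have hs := abs_lt.1 (hclose s h1 h2)
  rcases le_total r σ with h | h
  · linarith [sub_le_reflectedPath hl hr1 h]
  · have := abs_lt.1 (hclose r h (hr2.trans_lt h2))
    linarith

theorem lt_timeAbove_reflectedPath {ξ : ℝ≥0 → ℝ} (hξ : IsCadlag ξ)
    (hl : LowerSemicontinuous ξ) {b : ℝ} (hb : 0 < b) (τ : ℝ≥0) :
    (τ : ℝ≥0∞) < timeAbove b (reflectedPath ξ τ) τ := by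
  obtain ⟨t, ht, h⟩ := exists_forall_reflectedPath_lt hξ hl (le_refl τ)
    (by rwa [reflectedPath_self hl]) hb
  exact lt_timeAbove_of_forall ht fun s h1 h2 => (h s h1.le h2).le

/-- A reflected path without positive jumps creeps upwards over `b`. -/
theorem reflectedPath_timeAbove {ξ : ℝ≥0 → ℝ} (hξ : IsCadlag ξ) (hl : LowerSemicontinuous ξ)
    {b : ℝ} (hb : 0 < b) {τ σ : ℝ≥0} (hσ : timeAbove b (reflectedPath ξ τ) τ = σ) :
    τ < σ ∧ reflectedPath ξ τ σ = b := by
  have hτσ : τ < σ := by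
    have := lt_timeAbove_reflectedPath hξ hl hb τ
    rw [hσ] at this
    exact_mod_cast this
  refine ⟨hτσ, le_antisymm ?_ ?_⟩
  · by_contra! h
    obtain ⟨r, hr1, hr2, hmin, hr⟩ := exists_reflectedPath_eq hl hτσ.le
    -- If the value at `σ` exceeded `b`, lower semicontinuity would put the reflected path above `b`
    -- already just before `σ`.
    have hev := hl σ (ξ r + b) (by linarith)
    have hrσ : r < σ := by
      refine lt_of_le_of_ne hr2 fun he => ?_
      rw [he] at hr
      linarith
    have : (𝓝[<] σ).NeBot := nhdsLT_neBot_of_exists_lt ⟨τ, hτσ⟩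
    obtain ⟨q, hq, hrq, hqσ⟩ := ((hev.filter_mono nhdsWithin_le_nhds).and
      (Ioo_mem_nhdsLT hrσ)).exists
    have h1 := sub_le_reflectedPath hl hr1 hrq.le
    have h2 := le_of_lt_timeAbove (f := reflectedPath ξ τ) (b := b) (hr1.trans_lt hrq)
      (by rw [hσ]; exact_mod_cast hqσ)
    linarith
  · by_contra! h
    obtain ⟨t, ht, hlt⟩ := exists_forall_reflectedPath_lt hξ hl hτσ.le h hb
    have : (σ : ℝ≥0∞) < timeAbove b (reflectedPath ξ τ) τ := by
      refine lt_timeAbove_of_forall ht fun s h1 h2 => ?_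
      rcases le_or_gt σ s with h | h
      · exact (hlt s h h2).le
      · exact le_of_lt_timeAbove h1 (by rw [hσ]; exact_mod_cast h)
    exact absurd this (by rw [hσ]; exact lt_irrefl _)

/-! ### The equation solved by refracted-reflected paths -/

/-- On `[τ, T]` the path `V` is nonnegative and solves `dV = dξ - δ 1_{V > b} dt + dR`, where `R` is
nondecreasing and increases only when `V` is at `0`. The process `R` is not mentioned explicitly. -/
structure SolvesOn (δ b : ℝ) (ξ V : ℝ≥0 → ℝ) (τ T : ℝ≥0) : Prop where
  measurableAbove : MeasurableAbove b V τ T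
  nonneg : ∀ t, τ ≤ t → t ≤ T → 0 ≤ V t
  -- The next three fields say that `R` is nondecreasing, that it is flat while `V` is positive, and
  -- that it does not jump to a time at which `V` is positive.
  le_sub : ∀ s t, τ ≤ s → s ≤ t → t ≤ T → V s - ξ s - δ * occ b V s t ≤ V t - ξ t
  sub_le : ∀ s t, τ ≤ s → s ≤ t → t ≤ T → (∀ r, s < r → r ≤ t → 0 < V r) →
    V t - ξ t ≤ V s - ξ s - δ * occ b V s t
  left_le : ∀ s, τ < s → s ≤ T → 0 < V s → ∃ r < s, ∀ q, r ≤ q → τ ≤ q → q < s →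
    V s - ξ s ≤ V q - ξ q

namespace SolvesOn

variable {δ b : ℝ} {ξ V : ℝ≥0 → ℝ} {τ σ T : ℝ≥0}

theorem refl (h : 0 ≤ V τ) : SolvesOn δ b ξ V τ τ where
  measurableAbove := by
    refine Set.Subsingleton.measurableSet fun u hu v hv => ?_
    exact (le_antisymm hu.2.1 hu.1).trans (le_antisymm hv.1 hv.2.1)
  nonneg t h1 h2 := by rwa [le_antisymm h2 h1]
  le_sub s t h1 h2 h3 := by
    obtain rfl : s = τ := le_antisymm (h2.trans h3) h1
    obtain rfl : t = s := le_antisymm h3 h2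
    simp [occ]
  sub_le s t h1 h2 h3 _ := by
    obtain rfl : s = τ := le_antisymm (h2.trans h3) h1
    obtain rfl : t = s := le_antisymm h3 h2
    simp [occ]
  left_le s h1 h2 := absurd h1 (not_lt.2 h2)

theorem trans (h : SolvesOn δ b ξ V τ σ) (h' : SolvesOn δ b ξ V σ T) (hτ : τ ≤ σ) (hT : σ ≤ T) :
    SolvesOn δ b ξ V τ T := by
  have hm : MeasurableAbove b V τ T := by
    have : {u : ℝ≥0 | τ ≤ u ∧ u ≤ T ∧ b < V u} =
        {u : ℝ≥0 | τ ≤ u ∧ u ≤ σ ∧ b < V u} ∪ {u : ℝ≥0 | σ ≤ u ∧ u ≤ T ∧ b < V u} := by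
      ext u
      simp only [Set.mem_ofPred_eq, Set.mem_union]
      constructor
      · rintro ⟨h1, h2, h3⟩
        exact (le_total u σ).imp (fun h => ⟨h1, h, h3⟩) fun h => ⟨h, h2, h3⟩
      · rintro (⟨h1, h2, h3⟩ | ⟨h1, h2, h3⟩)
        · exact ⟨h1, h2.trans hT, h3⟩
        · exact ⟨hτ.trans h1, h2, h3⟩
    rw [MeasurableAbove, this]
    exact h.measurableAbove.union h'.measurableAbove
  refine ⟨hm, fun t h1 h2 => ?_, fun s t h1 h2 h3 => ?_, fun s t h1 h2 h3 hp => ?_,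
    fun s h1 h2 hp => ?_⟩
  · exact (le_total t σ).elim (h.nonneg t h1) fun hσ => h'.nonneg t hσ h2
  · rcases le_total t σ with ht | ht
    · exact h.le_sub s t h1 h2 ht
    rcases le_total σ s with hs | hs
    · exact h'.le_sub s t hs h2 h3
    · rw [← occ_add (hm.mono h1 h3) hs ht]
      linarith [h.le_sub s σ h1 hs le_rfl, h'.le_sub σ t le_rfl ht h3]
  · rcases le_total t σ with ht | ht
    · exact h.sub_le s t h1 h2 ht hp
    rcases le_total σ s with hs | hs
    · exact h'.sub_le s t hs h2 h3 hp
    · rw [← occ_add (hm.mono h1 h3) hs ht]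
      linarith [h.sub_le s σ h1 hs le_rfl fun r hr1 hr2 => hp r hr1 (hr2.trans ht),
        h'.sub_le σ t le_rfl ht h3 fun r hr1 hr2 => hp r (hs.trans_lt hr1) hr2]
  · rcases le_or_gt s σ with hs | hs
    · exact h.left_le s h1 hs hp
    · obtain ⟨r, hr, hq⟩ := h'.left_le s hs h2 hp
      exact ⟨max r σ, max_lt hr hs, fun q hq1 _ hq2 =>
        hq q ((le_max_left _ _).trans hq1) ((le_max_right _ _).trans hq1) hq2⟩

/-- The comparison estimate between paths with different drivers. -/
theorem sub_le_of_abs_le (hδ : 0 ≤ δ) {ξ' V' : ℝ≥0 → ℝ} {T : ℝ≥0} (h : SolvesOn δ b ξ V 0 T)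
    (h' : SolvesOn δ b ξ' V' 0 T) (h0 : V 0 = V' 0) {ε : ℝ}
    (hε : ∀ s ≤ T, |ξ s - ξ' s| ≤ ε) : V T - V' T ≤ 2 * ε := by
  have hpos : ∀ r ≤ T, ε < (V r - ξ r) - (V' r - ξ' r) → V' r < V r := by
    intro r hr hlt
    linarith [(abs_le.1 (hε r hr)).1]
  have hmain := le_of_no_upcrossing (G := fun t => (V t - ξ t) - (V' t - ξ' t)) (c := ε) (τ := 0)
    (T := T) ?_ ?_ ?_ (zero_le) le_rfl
  · linarith [(abs_le.1 (hε T le_rfl)).2]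
  · linarith [(abs_le.1 (hε 0 (zero_le))).1]
  · intro s t hs hst htT hr
    have hlt : ∀ r, s < r → r ≤ t → V' r < V r := fun r h1 h2 => hpos r (h2.trans htT) (hr r h1 h2)
    have hm := mul_le_mul_of_nonneg_left (occ_mono (h'.measurableAbove.mono hs htT)
      (h.measurableAbove.mono hs htT) hst fun r h1 h2 => (hlt r h1 h2.le).le) hδ
    have h1 := h.sub_le s t hs hst htT fun r h1 h2 =>
      (h'.nonneg r (zero_le) (h2.trans htT)).trans_lt (hlt r h1 h2)
    have h2 := h'.le_sub s t hs hst htT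
    linarith
  · intro s hs hsT hc e he
    have hVs : 0 < V s := (h'.nonneg s hs.le hsT).trans_lt (hpos s hsT hc)
    obtain ⟨r, hr, hq⟩ := h.left_le s hs hsT hVs
    obtain ⟨r', hr', hq'⟩ := exists_lt_forall_mul_sub_le hδ he hs
    refine ⟨max r r', max_lt hr hr', fun q hrq hτq hqs => ?_⟩
    have h2 := mul_le_mul_of_nonneg_left
      (occ_le (h'.measurableAbove.mono hτq hsT) hqs.le) hδ
    have h3 := hq' q ((le_max_right _ _).trans hrq) hqs
    linarith [h'.le_sub q s hτq hqs.le hsT, hq q ((le_max_left _ _).trans hrq) hτq hqs]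

end SolvesOn

/-! ### Each kind of stage solves the equation -/

theorem occ_congr {δ b : ℝ} {ξ A V : ℝ≥0 → ℝ} {τ : ℝ≥0} {z : ℝ}
    (hA : IsRefractedPath δ b ξ τ z A) {s t : ℝ≥0} (hV : MeasurableAbove b V s t) (hs : τ ≤ s)
    (hst : s ≤ t) (h : ∀ r, τ ≤ r → r < t → V r = A r) : occ b V s t = occ b A s t :=
  le_antisymm
    (occ_mono hV ((hA.measurableAbove t).mono hs le_rfl) hst
      fun r h1 h2 => (h r (hs.trans h1.le) h2).le)
    (occ_mono ((hA.measurableAbove t).mono hs le_rfl) hV hst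
      fun r h1 h2 => (h r (hs.trans h1.le) h2).ge)

/-- A path that follows a nonnegative refracted path and is possibly moved up to `0` at the final
time solves the equation. -/
theorem IsRefractedPath.solvesOn {δ b : ℝ} (hδ : 0 ≤ δ) {ξ A V : ℝ≥0 → ℝ} {τ T : ℝ≥0} {z : ℝ}
    (hA : IsRefractedPath δ b ξ τ z A) (hV : ∀ t, τ ≤ t → t < T → V t = A t)
    (hA0 : ∀ t, τ ≤ t → t < T → 0 ≤ A t) (hT : V T = max (A T) 0) :
    SolvesOn δ b ξ V τ T := by
  have hVA : ∀ t, τ ≤ t → t ≤ T → V t = max (A t) 0 := by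
    intro t h1 h2
    rcases h2.lt_or_eq with h | rfl
    · rw [hV t h1 h, max_eq_left (hA0 t h1 h)]
    · exact hT
  have hpos : ∀ t, τ ≤ t → t ≤ T → 0 < V t → V t = A t := by
    intro t h1 h2 h3
    rw [hVA t h1 h2] at h3 ⊢
    rcases le_total (A t) 0 with h | h
    · simp [h] at h3
    · exact max_eq_left h
  have hm : MeasurableAbove b V τ T := by
    have : {u : ℝ≥0 | τ ≤ u ∧ u ≤ T ∧ b < V u} =
        ({u : ℝ≥0 | τ ≤ u ∧ u ≤ T ∧ b < A u} ∩ Set.Iio T) ∪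
          ({T} ∩ {u : ℝ≥0 | τ ≤ u ∧ u ≤ T ∧ b < V u}) := by
      ext u
      simp only [Set.mem_ofPred_eq, Set.mem_union, Set.mem_inter_iff, Set.mem_Iio,
        Set.mem_singleton_iff]
      constructor
      · rintro ⟨h1, h2, h3⟩
        rcases h2.lt_or_eq with h | rfl
        · exact Or.inl ⟨⟨h1, h2, by rwa [← hV u h1 h]⟩, h⟩
        · exact Or.inr ⟨rfl, h1, h2, h3⟩
      · rintro (⟨⟨h1, h2, h3⟩, h⟩ | h)
        · exact ⟨h1, h2, by rwa [hV u h1 h]⟩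
        · exact h.2
    rw [MeasurableAbove, this]
    exact ((hA.measurableAbove T).inter measurableSet_Iio).union
      (Set.subsingleton_singleton.anti Set.inter_subset_left).measurableSet
  have hocc : ∀ s t, τ ≤ s → s ≤ t → t ≤ T → occ b V s t = occ b A s t := fun s t h1 h2 h3 =>
    occ_congr hA (hm.mono h1 h3) h1 h2 fun r hr1 hr2 => hV r hr1 (hr2.trans_le h3)
  refine ⟨hm, fun t h1 h2 => ?_, fun s t h1 h2 h3 => ?_, fun s t h1 h2 h3 hp => ?_,
    fun s h1 h2 hp => ?_⟩
  · rw [hVA t h1 h2]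
    exact le_max_right _ _
  · rcases h2.eq_or_lt with rfl | h
    · simp [occ]
    · rw [hocc s t h1 h2 h3, hVA t (h1.trans h2) h3, hV s h1 (h.trans_le h3)]
      linarith [hA.sub_eq h1 h2, le_max_left (A t) 0]
  · rcases h2.eq_or_lt with rfl | h
    · simp [occ]
    · rw [hocc s t h1 h2 h3, hpos t (h1.trans h2) h3 (hp t h le_rfl), hV s h1 (h.trans_le h3)]
      exact (hA.sub_eq h1 h2).le
  -- `A - ξ` is nonincreasing on the whole stage, so no localisation near `s` is needed.
  · refine ⟨τ, h1, fun q hq _ hqs => ?_⟩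
    rw [hpos s h1.le h2 hp, hV q hq (hqs.trans_le h2), hA.sub_eq hq hqs.le]
    linarith [mul_nonneg hδ (occ_nonneg (b := b) (V := A) hqs.le)]

/-- A path that follows a reflected path at most `b` solves the equation. -/
theorem solvesOn_of_reflectedPath {δ b : ℝ} {ξ V : ℝ≥0 → ℝ} (hl : LowerSemicontinuous ξ)
    {τ T : ℝ≥0} (hV : ∀ t, τ ≤ t → t ≤ T → V t = reflectedPath ξ τ t)
    (hb : ∀ t, τ ≤ t → t ≤ T → V t ≤ b) : SolvesOn δ b ξ V τ T := by
  have hm : MeasurableAbove b V τ T := by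
    have : {u : ℝ≥0 | τ ≤ u ∧ u ≤ T ∧ b < V u} = ∅ :=
      Set.eq_empty_of_forall_notMem fun u hu => absurd (hb u hu.1 hu.2.1) (not_le.2 hu.2.2)
    rw [MeasurableAbove, this]
    exact MeasurableSet.empty
  have hocc : ∀ s t, τ ≤ s → s ≤ t → t ≤ T → occ b V s t = 0 := fun s t h1 h2 h3 =>
    occ_eq_zero h2 fun r hr1 hr2 => hb r (h1.trans hr1) (hr2.trans h3)
  -- The running minimum of `ξ` is never attained at a time when the reflected path is positive.
  -- Hence the minimum does not change while `V` is positive.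
  have hself : ∀ r, τ ≤ r → r ≤ T → 0 < V r → ∀ t, r ≤ t → t ≤ T →
      ¬ ∀ s, τ ≤ s → s ≤ t → ξ r ≤ ξ s := by
    intro r h1 h2 hp t h3 h4 hmin
    obtain ⟨q, hq1, hq2, -, hq⟩ := exists_reflectedPath_eq hl h1
    rw [hV r h1 h2, hq] at hp
    linarith [hmin q hq1 (hq2.trans h3)]
  refine ⟨hm, fun t h1 h2 => ?_, fun s t h1 h2 h3 => ?_, fun s t h1 h2 h3 hp => ?_,
    fun s h1 h2 hp => ?_⟩
  · rw [hV t h1 h2]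
    exact reflectedPath_nonneg hl h1
  · obtain ⟨r, hr1, hr2, -, hr⟩ := exists_reflectedPath_eq hl h1
    rw [hocc s t h1 h2 h3, hV s h1 (h2.trans h3), hV t (h1.trans h2) h3, hr]
    linarith [sub_le_reflectedPath hl hr1 (hr2.trans h2)]
  · obtain ⟨r, hr1, hr2, hmin, hr⟩ := exists_reflectedPath_eq hl (h1.trans h2)
    have hrs : r ≤ s := by
      by_contra! h
      exact hself r hr1 (hr2.trans h3) (hp r h hr2) t hr2 h3 hmin
    rw [hocc s t h1 h2 h3, hV s h1 (h2.trans h3), hV t (h1.trans h2) h3, hr]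
    linarith [sub_le_reflectedPath hl hr1 hrs]
  · obtain ⟨r, hr1, hr2, hmin, hr⟩ := exists_reflectedPath_eq hl h1.le
    refine ⟨r, ?_, fun q hq1 hq2 hq3 => ?_⟩
    · refine lt_of_le_of_ne hr2 fun he => ?_
      subst he
      exact hself r hr1 h2 hp r le_rfl h2 hmin
    · rw [hV s h1.le h2, hV q hq2 (hq3.le.trans h2), hr]
      linarith [sub_le_reflectedPath hl hr1 hq1]

/-! ### Refracted-reflected paths solve the equation -/

/-- The starting time of a stage. -/
def Stage.time : Stage → ℝ≥0
  | .refract τ _ => τ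
  | .reflect τ => τ

/-- The level `z` of a refracting stage is nonnegative. -/
def Stage.LevelNonneg : Stage → Prop
  | .refract _ z => 0 ≤ z
  | .reflect _ => True

theorem Visits.levelNonneg {δ b : ℝ} {ξ : ℝ≥0 → ℝ} {x : ℝ} (hb : 0 < b) {S : Stage}
    (h : Visits δ b ξ x S) : S.LevelNonneg := by
  cases h with
  | start_refract hx => exact hx
  | start_reflect hx => trivial
  | down _ _ _ => trivial
  | up _ _ => exact hb.le

/-- The oscillations of size `b` of a càdlàg path do not accumulate: the points of a nonempty
bounded set `K` cannot all be followed by such an oscillation and another point of `K`. -/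
theorem not_forall_exists_oscillation {b : ℝ} {ξ : ℝ≥0 → ℝ} (hb : 0 < b) (hξ : IsCadlag ξ)
    {K : Set ℝ≥0} {T : ℝ≥0} (hKT : ∀ τ ∈ K, τ ≤ T) (hK : K.Nonempty) :
    ¬ ∀ τ ∈ K, ∃ σ' ∈ K, ∃ r s, τ ≤ r ∧ r ≤ s ∧ τ < s ∧ s ≤ σ' ∧ ξ s - ξ r = b := by
  intro hnext
  have hbdd : BddAbove K := ⟨T, hKT⟩
  have hlt : ∀ τ ∈ K, τ < sSup K := by
    intro τ hτ
    obtain ⟨σ', hσ', r, s, -, -, h1, h2, -⟩ := hnext τ hτ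
    exact (h1.trans_le h2).trans_le (le_csSup hbdd hσ')
  -- The supremum is not attained, so points of `K` accumulate at it from the left. Near the left
  -- limit `l` the path stays within `b / 2` of `l`, which excludes an increment equal to `b`.
  obtain ⟨l, hlim⟩ := (hξ (sSup K)).2
  obtain ⟨τ₀, hτ₀⟩ := hK
  have hev := hlim.eventually (Metric.ball_mem_nhds l (half_pos hb))
  obtain ⟨c, hc, hsub⟩ := (mem_nhdsLT_iff_exists_Ioo_subset' (hlt τ₀ hτ₀)).1 hev
  obtain ⟨τ, hτ, hcτ⟩ := exists_lt_of_lt_csSup ⟨τ₀, hτ₀⟩ hc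
  obtain ⟨σ', hσ', r, s, h1, h2, h3, h4, h5⟩ := hnext τ hτ
  have hs : |ξ s - l| < b / 2 := hsub ⟨hcτ.trans h3, h4.trans_lt (hlt σ' hσ')⟩
  have hr : |ξ r - l| < b / 2 := hsub ⟨hcτ.trans_le h1, (h2.trans h4).trans_lt (hlt σ' hσ')⟩
  linarith [(abs_lt.1 hs).2, (abs_lt.1 hr).1]

namespace IsRefractedReflectedPath

variable {δ b : ℝ} {ξ V : ℝ≥0 → ℝ} {x : ℝ}

theorem apply_of_visits_reflect (hb : 0 < b) (hξ : IsCadlag ξ) (hl : LowerSemicontinuous ξ)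
    (hV : IsRefractedReflectedPath δ b ξ x V) {τ : ℝ≥0}
    (h : Visits δ b ξ x (Stage.reflect τ)) : V τ = 0 := by
  rw [hV.reflect τ h τ le_rfl (lt_timeAbove_reflectedPath hξ hl hb τ), reflectedPath_self hl]

/-- When the stage ends, `A ≤ 0`, while the reflecting stage that follows has positive length and
sets `V = 0`. So `V = max A 0` at the final time too, and the overshoot below `0` becomes a jump of
`R`. -/
theorem solvesOn_refract (hδ : 0 ≤ δ) (hb : 0 < b) (hξ : IsCadlag ξ) (hl : LowerSemicontinuous ξ)
    (hV : IsRefractedReflectedPath δ b ξ x V) {τ : ℝ≥0} {z : ℝ} (hz : 0 ≤ z)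
    (h : Visits δ b ξ x (Stage.refract τ z)) {A : ℝ≥0 → ℝ} (hA : IsRefractedPath δ b ξ τ z A)
    {t : ℝ≥0} (hτ : τ ≤ t) (ht : (t : ℝ≥0∞) ≤ timeBelowZero A τ) : SolvesOn δ b ξ V τ t := by
  obtain ⟨A', hA', hVA'⟩ := hV.refract τ z h
  have hAA' : ∀ t, τ ≤ t → A' t = A t := fun t ht => hA'.unique hδ hA ht
  have hVA : ∀ t, τ ≤ t → (t : ℝ≥0∞) < timeBelowZero A τ → V t = A t := by
    intro t h1 h2
    rw [hVA' t h1 (by rwa [timeBelowZero_congr hAA']), hAA' t h1]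
  have hA0 : ∀ t, τ ≤ t → (t : ℝ≥0∞) < timeBelowZero A τ → 0 ≤ A t := by
    intro t h1 h2
    rcases h1.lt_or_eq with h3 | rfl
    · exact nonneg_of_lt_timeBelowZero h3 h2
    · rwa [hA.apply_start]
  refine hA.solvesOn hδ (fun s h1 h2 => hVA s h1 ?_) (fun s h1 h2 => hA0 s h1 ?_) ?_
  · exact lt_of_lt_of_le (by exact_mod_cast h2) ht
  · exact lt_of_lt_of_le (by exact_mod_cast h2) ht
  · rcases ht.lt_or_eq with h1 | h1
    · rw [hVA t hτ h1, max_eq_left (hA0 t hτ h1)]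
    · rw [max_eq_right (hA.apply_timeBelowZero_nonpos hδ hξ h1.symm)]
      exact hV.apply_of_visits_reflect hb hξ hl (Visits.down h hA h1.symm)

theorem apply_of_visits_refract (hδ : 0 ≤ δ) (hξ : IsCadlag ξ)
    (hV : IsRefractedReflectedPath δ b ξ x V) {τ : ℝ≥0} {z : ℝ} (hz : 0 < z)
    (h : Visits δ b ξ x (Stage.refract τ z)) : V τ = z := by
  obtain ⟨A, hA, hVA⟩ := hV.refract τ z h
  rw [hVA τ le_rfl (hA.lt_timeBelowZero hδ hξ hz), hA.apply_start]

theorem solvesOn_reflect (hδ : 0 ≤ δ) (hb : 0 < b) (hξ : IsCadlag ξ) (hl : LowerSemicontinuous ξ)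
    (hV : IsRefractedReflectedPath δ b ξ x V) {τ : ℝ≥0}
    (h : Visits δ b ξ x (Stage.reflect τ)) {t : ℝ≥0}
    (ht : (t : ℝ≥0∞) ≤ timeAbove b (reflectedPath ξ τ) τ) : SolvesOn δ b ξ V τ t := by
  have hlt : ∀ s, τ ≤ s → (s : ℝ≥0∞) < timeAbove b (reflectedPath ξ τ) τ →
      V s = reflectedPath ξ τ s ∧ V s ≤ b := by
    intro s h1 h2
    have h3 := hV.reflect τ h s h1 h2
    refine ⟨h3, ?_⟩
    rw [h3]
    rcases h1.lt_or_eq with h4 | rfl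
    · exact le_of_lt_timeAbove h4 h2
    · rw [reflectedPath_self hl]
      exact hb.le
  have hle : ∀ s, τ ≤ s → s ≤ t → V s = reflectedPath ξ τ s ∧ V s ≤ b := by
    intro s h1 h2
    have h3 : (s : ℝ≥0∞) ≤ timeAbove b (reflectedPath ξ τ) τ :=
      le_trans (by exact_mod_cast h2) ht
    rcases h3.lt_or_eq with h4 | h4
    · exact hlt s h1 h4
    -- At the final time the next stage prescribes `V = b`, which by creeping is also the value of
    -- the reflected path.
    · have h5 := hV.apply_of_visits_refract hδ hξ hb (Visits.up h h4.symm)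
      rw [(reflectedPath_timeAbove hξ hl hb h4.symm).2, h5]
      exact ⟨rfl, le_rfl⟩
  exact solvesOn_of_reflectedPath hl (fun s h1 h2 => (hle s h1 h2).1) fun s h1 h2 => (hle s h1 h2).2

/-- The delicate case is a first refracting stage of length zero; it forces `x = 0`, in agreement
with the reflecting stage that takes over. -/
theorem apply_zero (hδ : 0 ≤ δ) (hb : 0 < b) (hξ : IsCadlag ξ) (hl : LowerSemicontinuous ξ)
    (hV : IsRefractedReflectedPath δ b ξ x V) : V 0 = max x 0 := by
  rcases le_or_gt 0 x with hx | hx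
  · obtain ⟨A, hA, hVA⟩ := hV.refract 0 x (Visits.start_refract hx)
    rw [max_eq_left hx]
    rcases (le_timeBelowZero (f := A) (τ := 0)).lt_or_eq with h | h
    · rw [hVA 0 le_rfl h, hA.apply_start]
    · have h1 := hA.apply_timeBelowZero_nonpos hδ hξ h.symm
      rw [hA.apply_start] at h1
      rw [hV.apply_of_visits_reflect hb hξ hl (Visits.down (.start_refract hx) hA h.symm)]
      exact le_antisymm hx h1
  · rw [max_eq_right hx.le]
    exact hV.apply_of_visits_reflect hb hξ hl (Visits.start_reflect hx)

theorem solvesOn_of_visits (hδ : 0 ≤ δ) (hb : 0 < b) (hξ : IsCadlag ξ)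
    (hl : LowerSemicontinuous ξ) (hV : IsRefractedReflectedPath δ b ξ x V) {S : Stage}
    (h : Visits δ b ξ x S) : SolvesOn δ b ξ V 0 S.time := by
  have h0 : 0 ≤ V 0 := by
    rw [hV.apply_zero hδ hb hξ hl]
    exact le_max_right _ _
  induction h with
  | start_refract hx => exact SolvesOn.refl h0
  | start_reflect hx => exact SolvesOn.refl h0
  | @down τ σ z A h hA hσ ih =>
    have hτσ : τ ≤ σ := by
      have := le_timeBelowZero (f := A) (τ := τ)
      rw [hσ] at this
      exact_mod_cast this
    exact ih.trans (hV.solvesOn_refract hδ hb hξ hl (h.levelNonneg hb) h hA hτσ hσ.ge)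
      (zero_le) hτσ
  | @up τ σ h hσ ih =>
    exact ih.trans (hV.solvesOn_reflect hδ hb hξ hl h hσ.ge) (zero_le)
      (reflectedPath_timeAbove hξ hl hb hσ).1.le

theorem solvesOn (hδ : 0 ≤ δ) (hb : 0 < b) (hξ : IsCadlag ξ) (hl : LowerSemicontinuous ξ)
    (hV : IsRefractedReflectedPath δ b ξ x V) (T : ℝ≥0) : SolvesOn δ b ξ V 0 T := by
  -- If the equation fails on `[0, T]`, no stage started by time `T` can last until `T`. Every such
  -- stage is then followed by another, and the reflecting times up to `T` contradict
  -- `not_forall_exists_oscillation`.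
  by_contra hT
  have hdown : ∀ τ z, τ ≤ T → Visits δ b ξ x (Stage.refract τ z) →
      ∃ σ, τ ≤ σ ∧ σ ≤ T ∧ Visits δ b ξ x (Stage.reflect σ) := by
    intro τ z hτ h
    obtain ⟨A, hA, -⟩ := hV.refract τ z h
    rcases le_or_gt (T : ℝ≥0∞) (timeBelowZero A τ) with hle | hlt
    · exact absurd ((hV.solvesOn_of_visits hδ hb hξ hl h).trans
        (hV.solvesOn_refract hδ hb hξ hl (h.levelNonneg hb) h hA hτ hle) (zero_le) hτ) hT
    · obtain ⟨σ, hσ⟩ : ∃ σ : ℝ≥0, (σ : ℝ≥0∞) = _ := ⟨_, ENNReal.coe_toNNReal hlt.ne_top⟩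
      have h1 := le_timeBelowZero (f := A) (τ := τ)
      rw [← hσ] at h1 hlt
      exact ⟨σ, by exact_mod_cast h1, by exact_mod_cast hlt.le, Visits.down h hA hσ.symm⟩
  refine not_forall_exists_oscillation (K := {τ | τ ≤ T ∧ Visits δ b ξ x (Stage.reflect τ)}) hb hξ
    (fun τ hτ => hτ.1) ?_ ?_
  · rcases le_or_gt 0 x with hx | hx
    · obtain ⟨σ, -, h1, h2⟩ := hdown 0 x (zero_le) (Visits.start_refract hx)
      exact ⟨σ, h1, h2⟩
    · exact ⟨0, zero_le, Visits.start_reflect hx⟩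
  · rintro τ ⟨hτ, h⟩
    rcases le_or_gt (T : ℝ≥0∞) (timeAbove b (reflectedPath ξ τ) τ) with hle | hlt
    · exact absurd ((hV.solvesOn_of_visits hδ hb hξ hl h).trans
        (hV.solvesOn_reflect hδ hb hξ hl h hle) (zero_le) hτ) hT
    · obtain ⟨σ, hσ⟩ : ∃ σ : ℝ≥0, (σ : ℝ≥0∞) = _ := ⟨_, ENNReal.coe_toNNReal hlt.ne_top⟩
      rw [← hσ] at hlt
      obtain ⟨hτσ, hub⟩ := reflectedPath_timeAbove hξ hl hb hσ.symm
      obtain ⟨σ', h1, h2, h3⟩ := hdown σ b (by exact_mod_cast hlt.le) (Visits.up h hσ.symm)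
      obtain ⟨r, hr1, hr2, -, hr⟩ := exists_reflectedPath_eq hl hτσ.le
      exact ⟨σ', ⟨h2, h3⟩, r, σ, hr1, hr2, hτσ, h1, by rw [← hr, hub]⟩

/-- Refracted-reflected paths depend on their driving paths in a Lipschitz way, in the uniform
distance on compact time intervals. -/
theorem abs_sub_le (hδ : 0 ≤ δ) (hb : 0 < b) {ξ' V' : ℝ≥0 → ℝ} (hξ : IsCadlag ξ)
    (hj : NoPositiveJumps ξ) (hV : IsRefractedReflectedPath δ b ξ x V) (hξ' : IsCadlag ξ')
    (hj' : NoPositiveJumps ξ') (hV' : IsRefractedReflectedPath δ b ξ' x V') {T : ℝ≥0} {ε : ℝ}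
    (hε : ∀ s ≤ T, |ξ s - ξ' s| ≤ ε) : |V T - V' T| ≤ 2 * ε := by
  have hl := hξ.lowerSemicontinuous hj
  have hl' := hξ'.lowerSemicontinuous hj'
  have h := hV.solvesOn hδ hb hξ hl T
  have h' := hV'.solvesOn hδ hb hξ' hl' T
  have h0 : V 0 = V' 0 := by
    rw [hV.apply_zero hδ hb hξ hl, hV'.apply_zero hδ hb hξ' hl']
  refine abs_sub_le_iff.2 ⟨h.sub_le_of_abs_le hδ h' h0 hε,
    h'.sub_le_of_abs_le hδ h h0.symm fun s hs => ?_⟩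
  rw [abs_sub_comm]
  exact hε s hs

theorem iSup_abs_sub_le (hδ : 0 ≤ δ) (hb : 0 < b) {ξ' V' : ℝ≥0 → ℝ} (hξ : IsCadlag ξ)
    (hj : NoPositiveJumps ξ) (hV : IsRefractedReflectedPath δ b ξ x V) (hξ' : IsCadlag ξ')
    (hj' : NoPositiveJumps ξ') (hV' : IsRefractedReflectedPath δ b ξ' x V') (T : ℝ≥0) :
    ⨆ s ∈ Set.Icc 0 T, ENNReal.ofReal |V s - V' s| ≤
      2 * ⨆ s ∈ Set.Icc 0 T, ENNReal.ofReal |ξ s - ξ' s| := by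
  set D : ℝ≥0∞ := ⨆ s ∈ Set.Icc 0 T, ENNReal.ofReal |ξ s - ξ' s| with hD
  -- The real-valued estimate needs a finite `ε`; an infinite distance makes the bound trivial.
  rcases eq_or_ne D ⊤ with htop | htop
  · simp [htop]
  refine iSup₂_le fun s hs => ?_
  have hle : ∀ r ≤ s, |ξ r - ξ' r| ≤ D.toReal := fun r hr =>
    (ENNReal.ofReal_le_iff_le_toReal htop).1
      (le_iSup₂_of_le (f := fun s (_ : s ∈ Set.Icc 0 T) => ENNReal.ofReal |ξ s - ξ' s|) r
        ⟨zero_le, hr.trans hs.2⟩ le_rfl)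
  refine ENNReal.ofReal_le_of_le_toReal ?_
  simpa using hV.abs_sub_le hδ hb hξ hj hξ' hj' hV' hle

end IsRefractedReflectedPath

end RefractedReflected

theorem proposition2p1 {Ω : Type*} [MeasurableSpace Ω] (P : Measure Ω) [IsProbabilityMeasure P]
    (b δ : ℝ) (hb : 0 < b) (hδ : 0 ≤ δ) (x : ℝ)
    (X : ℝ≥0 → Ω → ℝ) (hX : IsSpectrallyNegativeLevy P x X)
    (hXunb : ¬ HasBoundedVariationPaths P X)
    (Xn : ℕ → ℝ≥0 → Ω → ℝ) (hXn : ∀ n, IsSpectrallyNegativeLevy P x (Xn n))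
    (happrox : StronglyApproximating P X Xn)
    (V : ℝ≥0 → Ω → ℝ) (hV : IsRefractedReflectedProcess P δ b x X V)
    (Vn : ℕ → ℝ≥0 → Ω → ℝ)
    (hVn : ∀ n, IsRefractedReflectedProcess P δ b x (Xn n) (Vn n)) :
    StronglyApproximating P V Vn := by
  filter_upwards [hX.cadlag, hX.noPositiveJumps, ae_all_iff.2 fun n => (hXn n).cadlag,
    ae_all_iff.2 fun n => (hXn n).noPositiveJumps, happrox, hV, ae_all_iff.2 hVn]
    with ω hc hj hcn hjn hlim hVω hVnω t ht
  have h2 : Tendsto (fun n => 2 * ⨆ s ∈ Set.Icc 0 t, ENNReal.ofReal |X s ω - Xn n s ω|) atTop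
      (𝓝 0) := by
    simpa using ENNReal.Tendsto.const_mul (a := 2) (hlim t ht) (Or.inr (by simp))
  exact tendsto_of_tendsto_of_tendsto_of_le_of_le tendsto_const_nhds h2 (fun n => zero_le)
    fun n => hVω.iSup_abs_sub_le hδ hb hc hj (hcn n) (hjn n) (hVnω n) t
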